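/- For real $x \ge 2$ let $\pi(x)$ denote the number of primes $p \le x$, and let $\log$ be the natural logarithm. There is a function $\varepsilon : \mathbb{R} \to \mathbb{R}$ with $\varepsilon(x) \to 0$ as $x \to \infty$ such that for all real $x \ge 2$ $$\prod_{p \le x} \log p = \bigl(\log x - 1 - \varepsilon(x)\bigr)^{\pi(x)},$$ where the product is over the primes $p \le x$; that is, $\prod_{p\le x} \log p = (\log x - 1 - o(1))^{\pi(x)}$ as $x \to \infty$. In particular, the geometric mean of $\log p$ over the primes $p \le x$ is asymptotic to $\log x - 1$: as $x \to \infty$, $$\Bigl(\prod_{p \le x} \log p\Bigr)^{1/\pi(x)} \sim \log x - 1,$$ i.e. the ratio of the two sides tends to $1$. -/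

import Mathlib

open Filter Topology Asymptotics

/-!
Write `π(x)` for the number of primes `p ≤ x`. Partial summation gives
`∑ log (log p) = π(x) log (log x) - J(x)` over the primes `p ≤ x`, where `J(x)` is the integral of
`π(t) / (t log t)` over `[2, x]`, so the geometric mean of `log p` over these primes is exactly
`log x * exp (-J(x) / π(x))` (`geom_mean_log_prime`). It is `log x - 1 + o(1)` as soon as
`J(x) / π(x) ~ 1 / log x`. By the prime number theorem `π(x) ~ x / log x`, the integrand is
asymptotic to `1 / (log t) ^ 2`, hence to the derivative of `x / (log x) ^ 2`, and therefore
`J(x) ~ x / (log x) ^ 2` (`isEquivalent_integral_primeCounting_div`), which is what is needed.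

The prime number theorem is proved by the Wiener-Ikehara method. Put
`h(v) = ψ(e ^ v) / e ^ v - 1` for `v > 0`, which is bounded by Chebyshev's estimate. Its Laplace
transform is `-ζ'/ζ (1 + s) / (1 + s) - 1 / s`, and this extends continuously to `0 ≤ re s` because
`ζ` does not vanish on the line `re s = 1` (`laplace_psiRelError`). Integrating the Laplace
transform against the tent function on a vertical segment turns it into the convolution of `h` with
a Fejér kernel; letting the segment approach the imaginary axis and using the Riemann-Lebesgue
lemma, this convolution tends to `0` (`tendsto_integral_mul_fejerKernel`). As the kernel is
nonnegative and can be concentrated at will, `h` cannot stay away from `0` on a whole interval of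
fixed length; since `e ^ v * (1 + h(v))` is monotone, `h` tends to `0`
(`tendsto_zero_of_continuous_laplace`).
-/

section

open MeasureTheory Set

/-! ### The Fejér kernel -/

/-- The Fejér kernel `y ↦ 2 (1 - cos y) / y ^ 2`, written as the cosine transform of the tent
function supported on `[-1, 1]`. -/
noncomputable def fejerKernel (y : ℝ) : ℝ :=
  ∫ t in (0 : ℝ)..1, 2 * (1 - t) * Real.cos (t * y)

lemma fejerKernel_of_ne_zero {y : ℝ} (hy : y ≠ 0) :
    fejerKernel y = 2 * (1 - Real.cos y) / y ^ 2 := by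
  have hderiv : ∀ t ∈ uIcc (0 : ℝ) 1, HasDerivAt
      (fun t : ℝ ↦ 2 * ((1 - t) * Real.sin (t * y) / y - Real.cos (t * y) / y ^ 2))
      (2 * (1 - t) * Real.cos (t * y)) t := by
    intro t _
    have h1 : HasDerivAt (fun t : ℝ ↦ t * y) y t := by
      simpa using (hasDerivAt_id t).mul_const y
    have h2 : HasDerivAt (fun t : ℝ ↦ 1 - t) (-1) t := by
      simpa using (hasDerivAt_id t).const_sub 1
    have h3 := (((h2.mul h1.sin).div_const y).sub (h1.cos.div_const (y ^ 2))).const_mul 2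
    refine h3.congr_deriv ?_
    field_simp
    ring
  rw [fejerKernel, intervalIntegral.integral_eq_sub_of_hasDerivAt hderiv
    ((by fun_prop : Continuous fun t : ℝ ↦ 2 * (1 - t) * Real.cos (t * y)).intervalIntegrable _ _)]
  simp
  field_simp
  ring

lemma fejerKernel_zero : fejerKernel 0 = 1 := by
  have : ∀ t ∈ uIcc (0 : ℝ) 1, HasDerivAt (fun t : ℝ ↦ 2 * t - t ^ 2) (2 * (1 - t)) t := by
    intro t _
    have h := ((hasDerivAt_id t).const_mul 2).sub ((hasDerivAt_id t).pow 2)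
    refine h.congr_deriv ?_
    simp
    ring
  simp only [fejerKernel, mul_zero, Real.cos_zero, mul_one]
  rw [intervalIntegral.integral_eq_sub_of_hasDerivAt this
    ((by fun_prop : Continuous fun t : ℝ ↦ 2 * (1 - t)).intervalIntegrable _ _)]
  norm_num

lemma fejerKernel_nonneg (y : ℝ) : 0 ≤ fejerKernel y := by
  rcases eq_or_ne y 0 with rfl | hy
  · simp [fejerKernel_zero]
  · rw [fejerKernel_of_ne_zero hy]
    have := Real.cos_le_one y
    have : 0 ≤ 1 - Real.cos y := by linarith
    positivity

lemma fejerKernel_le (y : ℝ) : fejerKernel y ≤ 5 * (1 + y ^ 2)⁻¹ := by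
  rcases eq_or_ne y 0 with rfl | hy
  · norm_num [fejerKernel_zero]
  · have hy2 : 0 < y ^ 2 := by positivity
    rw [fejerKernel_of_ne_zero hy, ← div_eq_mul_inv, div_le_div_iff₀ hy2 (by positivity)]
    have h1 := Real.neg_one_le_cos y
    have h2 := Real.one_sub_sq_div_two_le_cos (x := y)
    nlinarith [mul_nonneg hy2.le (by linarith : 0 ≤ 1 + Real.cos y)]

lemma continuous_fejerKernel : Continuous fejerKernel := by
  unfold fejerKernel
  apply intervalIntegral.continuous_parametric_intervalIntegral_of_continuous'
  fun_prop

lemma integrable_fejerKernel : Integrable fejerKernel := by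
  refine (integrable_inv_one_add_sq.const_mul 5).mono'
    continuous_fejerKernel.aestronglyMeasurable (ae_of_all _ fun y ↦ ?_)
  rw [Real.norm_of_nonneg (fejerKernel_nonneg y)]
  exact fejerKernel_le y

lemma integral_fejerKernel_pos : 0 < ∫ y, fejerKernel y :=
  integral_pos_of_integrable_nonneg_nonzero continuous_fejerKernel integrable_fejerKernel
    fejerKernel_nonneg (x := 0) (by simp [fejerKernel_zero])

lemma fejerKernel_eq_re (y : ℝ) : fejerKernel y =
    (∫ t in (0 : ℝ)..1, ((2 * (1 - t) : ℝ) : ℂ) * Complex.exp (Complex.I * (t * y))).re := by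
  have h := Complex.reCLM.intervalIntegral_comp_comm (μ := volume) (a := 0) (b := 1)
    (f := fun t : ℝ ↦ ((2 * (1 - t) : ℝ) : ℂ) * Complex.exp (Complex.I * (t * y)))
    (Continuous.intervalIntegrable (by fun_prop) _ _)
  simp only [Complex.reCLM_apply] at h
  rw [← h, fejerKernel]
  congr 1
  ext t
  rw [Complex.re_ofReal_mul, mul_comm Complex.I, ← Complex.ofReal_mul, Complex.exp_ofReal_mul_I_re]

lemma integrable_mul_fejerKernel {h : ℝ → ℝ} {B : ℝ} (hm : Measurable h) (hB : ∀ v, |h v| ≤ B)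
    {T : ℝ} (hT : 0 < T) (u : ℝ) : Integrable fun v ↦ h v * fejerKernel (T * (u - v)) := by
  refine Integrable.bdd_mul ?_ hm.aestronglyMeasurable (ae_of_all _ hB)
  exact (integrable_fejerKernel.comp_mul_left' hT.ne').comp_sub_left u

/-! ### A Tauberian theorem for Laplace transforms -/

/-- Smoothing a Laplace transform on a vertical segment against the tent function gives
convolution with the Fejér kernel. -/
lemma integral_mul_laplace_eq {h : ℝ → ℝ} {B : ℝ} (hm : Measurable h) (hB : ∀ v, |h v| ≤ B)
    {σ : ℝ} (hσ : 0 < σ) (T u : ℝ) :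
    (∫ t in (0 : ℝ)..1, ((2 * (1 - t) : ℝ) : ℂ) * Complex.exp (Complex.I * (t * (T * u))) *
      ∫ v in Ioi (0 : ℝ), (h v : ℂ) * Complex.exp (-(σ + Complex.I * (T * t : ℝ)) * v)).re =
    ∫ v in Ioi (0 : ℝ), h v * Real.exp (-σ * v) * fejerKernel (T * (u - v)) := by
  have hexp : IntegrableOn (fun v : ℝ ↦ Real.exp (-σ * v)) (Ioi 0) :=
    integrableOn_exp_mul_Ioi (by linarith) 0
  have hint : Integrable (Function.uncurry fun (t v : ℝ) ↦
      ((2 * (1 - t) : ℝ) : ℂ) * Complex.exp (Complex.I * (t * (T * u))) *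
      ((h v : ℂ) * Complex.exp (-(σ + Complex.I * (T * t : ℝ)) * v)))
      ((volume.restrict (uIoc 0 1)).prod (volume.restrict (Ioi (0 : ℝ)))) := by
    have hb : Integrable (fun z : ℝ × ℝ ↦ (2 : ℝ) * (B * Real.exp (-σ * z.2)))
        ((volume.restrict (uIoc 0 1)).prod (volume.restrict (Ioi (0 : ℝ)))) := by
      have h1 : Integrable (fun _ : ℝ ↦ (2 : ℝ)) (volume.restrict (uIoc (0 : ℝ) 1)) := by
        rw [uIoc_of_le zero_le_one]; exact integrable_const _
      exact h1.mul_prod (hexp.const_mul B)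
    refine hb.mono' ?_ ?_
    · refine Measurable.aestronglyMeasurable ?_
      simp only [Function.uncurry_def]
      fun_prop
    · have : ∀ᵐ z : ℝ × ℝ ∂((volume.restrict (uIoc 0 1)).prod (volume.restrict (Ioi (0 : ℝ)))),
          z.1 ∈ uIoc (0 : ℝ) 1 := by
        rw [Measure.prod_restrict]
        filter_upwards [ae_restrict_mem (measurableSet_uIoc.prod measurableSet_Ioi)] with z hz
        exact hz.1
      filter_upwards [this] with z hz
      rw [uIoc_of_le zero_le_one] at hz
      simp only [Function.uncurry_def, norm_mul, Complex.norm_real, Complex.norm_exp]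
      have e1 : (Complex.I * (z.1 * (T * u)) : ℂ).re = 0 := by simp
      have e2 : (-(σ + Complex.I * (T * z.1 : ℝ)) * z.2 : ℂ).re = -σ * z.2 := by simp
      rw [e1, e2, Real.exp_zero, mul_one]
      have h1 : ‖2 * (1 - z.1)‖ ≤ 2 := by
        rw [Real.norm_eq_abs, abs_le]; constructor <;> linarith [hz.1, hz.2]
      rw [← norm_mul]
      exact mul_le_mul h1 (mul_le_mul_of_nonneg_right (hB _) (Real.exp_pos _).le) (by positivity)
        (by norm_num)
  simp_rw [← integral_const_mul]
  rw [intervalIntegral_integral_swap hint]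
  have hpt : ∀ v : ℝ, (∫ t in (0 : ℝ)..1,
      ((2 * (1 - t) : ℝ) : ℂ) * Complex.exp (Complex.I * (t * (T * u))) *
      ((h v : ℂ) * Complex.exp (-(σ + Complex.I * (T * t : ℝ)) * v))) =
      ((h v * Real.exp (-σ * v) : ℝ) : ℂ) * ∫ t in (0 : ℝ)..1,
        ((2 * (1 - t) : ℝ) : ℂ) * Complex.exp (Complex.I * (t * (T * (u - v) : ℝ))) := by
    intro v
    rw [← intervalIntegral.integral_const_mul]
    congr 1
    ext t
    have : Complex.exp (Complex.I * (t * (T * u))) *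
        Complex.exp (-(σ + Complex.I * (T * t : ℝ)) * v) =
        Complex.exp (-σ * v) * Complex.exp (Complex.I * (t * (T * (u - v) : ℝ))) := by
      rw [← Complex.exp_add, ← Complex.exp_add]
      congr 1
      push_cast
      ring
    push_cast at this ⊢
    linear_combination (2 * (1 - t) * h v : ℂ) * this
  simp_rw [hpt]
  rw [← RCLike.re_eq_complex_re, ← integral_re]
  · simp only [RCLike.re_eq_complex_re, Complex.re_ofReal_mul, ← fejerKernel_eq_re]
  · have h2 := hint.integral_prod_right
    refine h2.congr (ae_of_all _ fun v ↦ ?_)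
    simp only [Function.uncurry_apply_pair]
    rw [← hpt v, intervalIntegral.integral_of_le zero_le_one, uIoc_of_le zero_le_one]

/-- If the Laplace transform of a bounded function on `(0, ∞)` extends continuously to the closed
half-plane `0 ≤ σ`, then its Fejér means tend to `0`. -/
lemma tendsto_integral_mul_fejerKernel {h : ℝ → ℝ} {B : ℝ} (hm : Measurable h)
    (hB : ∀ v, |h v| ≤ B) (h0 : ∀ v ≤ 0, h v = 0) {F : ℝ → ℝ → ℂ}
    (hF : Continuous (Function.uncurry F))
    (hFeq : ∀ σ > 0, ∀ τ : ℝ,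
      F σ τ = ∫ v in Ioi (0 : ℝ), (h v : ℂ) * Complex.exp (-(σ + Complex.I * τ) * v))
    {T : ℝ} (hT : 0 < T) :
    Tendsto (fun u ↦ ∫ v, h v * fejerKernel (T * (u - v))) atTop (𝓝 0) := by
  -- Both sides of `integral_mul_laplace_eq` converge as `σ → 0+`.
  have key : ∀ u : ℝ, (∫ t in (0 : ℝ)..1,
      ((2 * (1 - t) : ℝ) : ℂ) * Complex.exp (Complex.I * (t * (T * u))) * F 0 (T * t)).re =
      ∫ v, h v * fejerKernel (T * (u - v)) := by
    intro u
    have hc : Continuous fun σ : ℝ ↦ (∫ t in (0 : ℝ)..1,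
        ((2 * (1 - t) : ℝ) : ℂ) * Complex.exp (Complex.I * (t * (T * u))) * F σ (T * t)).re := by
      refine Complex.continuous_re.comp ?_
      apply intervalIntegral.continuous_parametric_intervalIntegral_of_continuous'
      have : Continuous fun z : ℝ × ℝ ↦ F z.1 (T * z.2) :=
        hF.comp (f := fun z : ℝ × ℝ ↦ (z.1, T * z.2)) (by fun_prop)
      simp only [Function.uncurry_def]
      fun_prop
    have hl := (hc.tendsto 0).mono_left (nhdsWithin_le_nhds (s := Ioi 0))
    have hset : ∫ v, h v * fejerKernel (T * (u - v)) =
        ∫ v in Ioi (0 : ℝ), h v * fejerKernel (T * (u - v)) := by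
      refine (setIntegral_eq_integral_of_forall_compl_eq_zero fun v hv ↦ ?_).symm
      rw [h0 v (not_lt.mp hv), zero_mul]
    have hr : Tendsto (fun σ : ℝ ↦ ∫ v in Ioi (0 : ℝ),
        h v * Real.exp (-σ * v) * fejerKernel (T * (u - v))) (𝓝[>] 0)
        (𝓝 (∫ v in Ioi (0 : ℝ), h v * fejerKernel (T * (u - v)))) := by
      have hi := (integrable_mul_fejerKernel hm hB hT u).restrict (s := Ioi 0)
      refine tendsto_integral_filter_of_dominated_convergence _ ?_ ?_ hi.norm ?_
      · refine Eventually.of_forall fun σ ↦ ?_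
        have := continuous_fejerKernel.measurable
        refine Measurable.aestronglyMeasurable ?_
        fun_prop
      · filter_upwards [self_mem_nhdsWithin] with σ (hσ : 0 < σ)
        filter_upwards [ae_restrict_mem measurableSet_Ioi] with v (hv : 0 < v)
        rw [mul_right_comm, norm_mul]
        refine mul_le_of_le_one_right (norm_nonneg _) ?_
        rw [Real.norm_of_nonneg (Real.exp_pos _).le, Real.exp_le_one_iff]
        nlinarith
      · refine ae_of_all _ fun v ↦ ?_
        have : Continuous fun σ : ℝ ↦ h v * Real.exp (-σ * v) * fejerKernel (T * (u - v)) := by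
          fun_prop
        simpa using (this.tendsto 0).mono_left (nhdsWithin_le_nhds (s := Ioi 0))
    rw [hset]
    refine tendsto_nhds_unique (hl.congr' ?_) hr
    filter_upwards [self_mem_nhdsWithin] with σ (hσ : 0 < σ)
    rw [← integral_mul_laplace_eq hm hB hσ]
    simp_rw [hFeq σ hσ]
  simp_rw [← key]
  -- The left side tends to `0` as `u → ∞` by the Riemann-Lebesgue lemma.
  have hRL := Real.tendsto_integral_exp_smul_cocompact
    ((Ioc (0 : ℝ) 1).indicator fun t ↦ ((2 * (1 - t) : ℝ) : ℂ) * F 0 (T * t))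
  have hscale : Tendsto (fun u : ℝ ↦ -(T / (2 * Real.pi)) * u) atTop (cocompact ℝ) := by
    rw [cocompact_eq_atBot_atTop]
    refine Tendsto.mono_right ?_ le_sup_left
    exact tendsto_id.const_mul_atTop_of_neg (by have := Real.pi_pos; simp; positivity)
  have h2 := (Complex.continuous_re.tendsto 0).comp (hRL.comp hscale)
  rw [Complex.zero_re] at h2
  refine h2.congr fun u ↦ ?_
  simp only [Function.comp_apply]
  rw [intervalIntegral.integral_of_le zero_le_one, ← integral_indicator measurableSet_Ioc]
  congr 2
  ext t
  by_cases ht : t ∈ Ioc (0 : ℝ) 1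
  · simp only [indicator_of_mem ht, Circle.smul_def, Real.fourierChar_apply, smul_eq_mul]
    have : (((2 * Real.pi * -(t * (-(T / (2 * Real.pi)) * u)) : ℝ) : ℂ) * Complex.I) =
        Complex.I * (t * (T * u)) := by
      rw [mul_comm, ← Complex.ofReal_mul, ← Complex.ofReal_mul]
      congr 2
      field_simp [Real.pi_ne_zero]
    rw [this]
    ring
  · simp [indicator_of_notMem ht]

/-- If the Fejér means of a bounded function at every scale tend to `0`, then far out the function
cannot stay above a positive level on an interval of fixed length. -/
lemma eventually_exists_lt_of_tendsto_fejer {h : ℝ → ℝ} {B : ℝ} (hm : Measurable h)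
    (hB : ∀ v, |h v| ≤ B)
    (hK : ∀ T > 0, Tendsto (fun u ↦ ∫ v, h v * fejerKernel (T * (u - v))) atTop (𝓝 0))
    {a η : ℝ} (ha : 0 < a) (hη : 0 < η) :
    ∀ᶠ u in atTop, ∃ v ∈ Icc u (u + η), h v < a := by
  set c := ∫ y, fejerKernel y with hc
  have hcpos : 0 < c := integral_fejerKernel_pos
  have hB0 : 0 ≤ B := (abs_nonneg _).trans (hB 0)
  -- Choose `A` so that `[-A, A]` carries most of the mass of the kernel.
  obtain ⟨A, hA0, hA⟩ : ∃ A > 0, c * (B / (a + B)) < ∫ y in (-A)..A, fejerKernel y := by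
    have ht := intervalIntegral_tendsto_integral integrable_fejerKernel tendsto_neg_atTop_atBot
      tendsto_id
    have hlt : c * (B / (a + B)) < c :=
      mul_lt_of_lt_one_right hcpos ((div_lt_one (by linarith)).mpr (by linarith))
    obtain ⟨A, h1, h2⟩ := ((ht.eventually_const_lt hlt).and (eventually_gt_atTop 0)).exists
    exact ⟨A, h2, h1⟩
  -- With this scale, the mass on `[-A, A]` sits over a window of length `η`.
  set T := 2 * A / η with hTdef
  have hT : 0 < T := by positivity
  set k : ℝ → ℝ := (Ioc (-A) A).indicator fejerKernel with hk
  have hki : Integrable k := integrable_fejerKernel.indicator measurableSet_Ioc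
  have hkint : ∫ y, k y = ∫ y in (-A)..A, fejerKernel y := by
    rw [hk, integral_indicator measurableSet_Ioc, intervalIntegral.integral_of_le (by linarith)]
  have hpos : 0 < (a + B) * (∫ y, k y) - B * c := by
    rw [hkint]
    have h1 : 0 < a + B := by linarith
    have h2 := mul_lt_mul_of_pos_left hA h1
    have h3 : (a + B) * (c * (B / (a + B))) = B * c := by field_simp
    linarith
  have hlim := ((hK T hT).comp
    (tendsto_atTop_add_const_right _ (η / 2) tendsto_id)).eventually_lt_const
    (show 0 < T⁻¹ * ((a + B) * (∫ y, k y) - B * c) by positivity)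
  filter_upwards [hlim] with u hu
  by_contra! hcon
  refine absurd hu (not_lt.mpr ?_)
  simp only [Function.comp_apply, id]
  have hscale : ∀ f : ℝ → ℝ, ∫ v, f (T * (u + η / 2 - v)) = T⁻¹ * ∫ y, f y := by
    intro f
    rw [integral_sub_left_eq_self (fun x ↦ f (T * x)) volume (u + η / 2),
      Measure.integral_comp_mul_left, abs_of_pos (inv_pos.mpr hT), smul_eq_mul]
  have hint : ∀ f : ℝ → ℝ, Integrable f → Integrable fun v ↦ f (T * (u + η / 2 - v)) :=
    fun f hf ↦ (hf.comp_mul_left' hT.ne').comp_sub_left _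
  -- If `a ≤ h` on the window centred at `u + η / 2`, then `(a + B) 1_[-A, A] - B` times the kernel
  -- bounds the integrand from below, and the choice of `A` makes its integral positive.
  calc T⁻¹ * ((a + B) * (∫ y, k y) - B * c)
      = ∫ v, ((a + B) * k (T * (u + η / 2 - v)) - B * fejerKernel (T * (u + η / 2 - v))) := by
        rw [integral_sub ((hint k hki).const_mul _) ((hint _ integrable_fejerKernel).const_mul _),
          integral_const_mul, integral_const_mul, hscale k, hscale fejerKernel]
        ring
    _ ≤ ∫ v, h v * fejerKernel (T * (u + η / 2 - v)) := by
        refine integral_mono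
          (((hint k hki).const_mul _).sub ((hint _ integrable_fejerKernel).const_mul _))
          (integrable_mul_fejerKernel hm hB hT _) fun v ↦ ?_
        have hKn := fejerKernel_nonneg (T * (u + η / 2 - v))
        by_cases hv : T * (u + η / 2 - v) ∈ Ioc (-A) A
        · simp only [hk, indicator_of_mem hv]
          have hTη : T * (η / 2) = A := by rw [hTdef]; field_simp
          have hv' : v ∈ Icc u (u + η) := by
            constructor <;> by_contra! hlt <;> nlinarith [hv.1, hv.2]
          nlinarith [hcon v hv']
        · simp only [hk, indicator_of_notMem hv]
          nlinarith [(abs_le.mp (hB v)).1]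

/-- A Tauberian theorem of Wiener-Ikehara type. A bounded function `h` on `(0, ∞)` for which
`e ^ u * (1 + h u)` is monotone, and whose Laplace transform extends continuously to the closed
right half-plane, tends to `0`. -/
theorem tendsto_zero_of_continuous_laplace {h : ℝ → ℝ} {B : ℝ} (hm : Measurable h)
    (hB : ∀ v, |h v| ≤ B) (h0 : ∀ v ≤ 0, h v = 0)
    (hmono : MonotoneOn (fun u ↦ Real.exp u * (1 + h u)) (Ioi 0)) {F : ℝ → ℝ → ℂ}
    (hF : Continuous (Function.uncurry F))
    (hFeq : ∀ σ > 0, ∀ τ : ℝ,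
      F σ τ = ∫ v in Ioi (0 : ℝ), (h v : ℂ) * Complex.exp (-(σ + Complex.I * τ) * v)) :
    Tendsto h atTop (𝓝 0) := by
  have hK : ∀ T > 0, Tendsto (fun u ↦ ∫ v, h v * fejerKernel (T * (u - v))) atTop (𝓝 0) :=
    fun T hT ↦ tendsto_integral_mul_fejerKernel hm hB h0 hF hFeq hT
  have hKneg : ∀ T > 0,
      Tendsto (fun u ↦ ∫ v, (-h v) * fejerKernel (T * (u - v))) atTop (𝓝 0) := by
    intro T hT
    simpa [integral_neg] using (hK T hT).neg
  have hcont : ∀ s : ℝ,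
      Tendsto (fun η : ℝ ↦ Real.exp (s * η) * (1 + s * η) - 1) (𝓝[>] 0) (𝓝 0) := by
    intro s
    have : Continuous fun η : ℝ ↦ Real.exp (s * η) * (1 + s * η) - 1 := by fun_prop
    simpa using (this.tendsto 0).mono_left (nhdsWithin_le_nhds (s := Ioi 0))
  rw [tendsto_order]
  constructor
  · intro b hb
    obtain ⟨η, hη1, hη : 0 < η, hη2 : η < 1⟩ := (((hcont (-1)).eventually_const_lt hb).and
      ((eventually_mem_nhdsWithin).and (nhdsWithin_le_nhds (eventually_lt_nhds one_pos)))).exists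
    have hev := eventually_exists_lt_of_tendsto_fejer hm.neg (fun v ↦ by simpa using hB v) hKneg
      hη hη
    filter_upwards [(tendsto_atTop_add_const_right _ (-η) tendsto_id).eventually hev,
      eventually_gt_atTop 1] with u ⟨v, hv, hlt⟩ hu
    simp only [id, Pi.neg_apply] at hv hlt
    have hle := hmono (show v ∈ Ioi 0 by simp; linarith [hv.1]) (show u ∈ Ioi 0 by simp; linarith)
      (by linarith [hv.2])
    have h1 : Real.exp (v - u) * (1 + h v) ≤ 1 + h u := by
      rw [Real.exp_sub, div_mul_eq_mul_div, div_le_iff₀ (Real.exp_pos u)]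
      linarith
    have h2 : Real.exp (-1 * η) ≤ Real.exp (v - u) := Real.exp_le_exp.mpr (by linarith [hv.1])
    have h3 : Real.exp (-1 * η) * (1 + -1 * η) ≤ Real.exp (v - u) * (1 + h v) :=
      mul_le_mul h2 (by linarith) (by linarith) (Real.exp_pos _).le
    linarith
  · intro b hb
    obtain ⟨η, hη1, hη : 0 < η⟩ := (((hcont 1).eventually_lt_const hb).and
      (eventually_mem_nhdsWithin)).exists
    have hev := eventually_exists_lt_of_tendsto_fejer hm hB hK hη hη
    filter_upwards [hev, eventually_gt_atTop 0] with u ⟨v, hv, hlt⟩ hu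
    have hle := hmono (show u ∈ Ioi 0 from hu) (show v ∈ Ioi 0 from hu.trans_le hv.1) hv.1
    have h1 : 1 + h u ≤ Real.exp (v - u) * (1 + h v) := by
      rw [Real.exp_sub, div_mul_eq_mul_div, le_div_iff₀ (Real.exp_pos u)]
      linarith
    have h2 : Real.exp (v - u) ≤ Real.exp (1 * η) := Real.exp_le_exp.mpr (by linarith [hv.2])
    have h3 : Real.exp (v - u) * (1 + h v) ≤ Real.exp (v - u) * (1 + 1 * η) :=
      mul_le_mul_of_nonneg_left (by linarith) (Real.exp_pos _).le
    have h4 : Real.exp (v - u) * (1 + 1 * η) ≤ Real.exp (1 * η) * (1 + 1 * η) :=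
      mul_le_mul_of_nonneg_right h2 (by linarith)
    linarith

/-! ### The prime number theorem -/

open ArithmeticFunction.vonMangoldt (LFunctionResidueClassAux residueClass)

/-- The relative error `ψ(e ^ v) / e ^ v - 1` in the prime number theorem on a logarithmic scale,
extended by `0` to `v ≤ 0`. -/
noncomputable def psiRelError (v : ℝ) : ℝ :=
  if v ≤ 0 then 0 else Chebyshev.psi (Real.exp v) / Real.exp v - 1

lemma measurable_psiRelError : Measurable psiRelError := by
  have := Chebyshev.psi_mono.measurable
  refine Measurable.ite measurableSet_Iic measurable_const ?_
  fun_prop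

lemma abs_psiRelError_le (v : ℝ) : |psiRelError v| ≤ Real.log 4 + 4 := by
  have h4 : 0 < Real.log 4 := Real.log_pos (by norm_num)
  unfold psiRelError
  split_ifs with hv
  · simp; linarith
  · have h1 : 0 ≤ Chebyshev.psi (Real.exp v) / Real.exp v :=
      div_nonneg (Chebyshev.psi_nonneg _) (Real.exp_pos v).le
    have h2 : Chebyshev.psi (Real.exp v) / Real.exp v ≤ Real.log 4 + 4 := by
      rw [div_le_iff₀ (Real.exp_pos v)]
      exact Chebyshev.psi_le_const_mul_self (Real.exp_pos v).le
    rw [abs_le]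
    constructor <;> linarith

lemma exp_mul_one_add_psiRelError {u : ℝ} (hu : 0 < u) :
    Real.exp u * (1 + psiRelError u) = Chebyshev.psi (Real.exp u) := by
  rw [psiRelError, if_neg hu.not_ge]
  field_simp
  ring

/-- The Mellin transform of `ψ` in logarithmic coordinates, shifted to the edge `re s = 1` of the
half-plane of convergence. -/
lemma LSeries_vonMangoldt_eq_integral {s : ℂ} (hs : 0 < s.re) :
    LSeries (fun n ↦ (ArithmeticFunction.vonMangoldt n : ℂ)) (1 + s) =
      (1 + s) * ∫ v in Ioi (0 : ℝ),
        ((Chebyshev.psi (Real.exp v) / Real.exp v : ℝ) : ℂ) * Complex.exp (-s * v) := by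
  have hpsi : ∀ t : ℝ, (∑ k ∈ Finset.Icc 1 ⌊t⌋₊, ArithmeticFunction.vonMangoldt k) =
      Chebyshev.psi t := fun t ↦ rfl
  rw [LSeries_eq_mul_integral_of_nonneg _ (zero_le_one) (by simpa using hs) ?_
    fun n ↦ ArithmeticFunction.vonMangoldt_nonneg]
  · congr 1
    rw [← Real.exp_zero, ← integral_comp_exp_Ioi]
    refine setIntegral_congr_fun measurableSet_Ioi fun v _ ↦ ?_
    rw [← Complex.ofReal_sum, hpsi, Complex.real_smul, Complex.cpow_def_of_ne_zero
      (by exact_mod_cast (Real.exp_pos v).ne'), ← Complex.ofReal_log (Real.exp_pos v).le,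
      Real.log_exp]
    have h : ((Real.exp v : ℝ) : ℂ) * Complex.exp (v * -(1 + s + 1)) =
        ((Real.exp v : ℝ) : ℂ)⁻¹ * Complex.exp (-s * v) := by
      push_cast
      rw [← Complex.exp_neg, ← Complex.exp_add, ← Complex.exp_add]
      congr 1
      ring
    push_cast at h ⊢
    linear_combination (Chebyshev.psi (Real.exp v) : ℂ) * h
  · refine IsBigO.of_bound (Real.log 4 + 4) (Eventually.of_forall fun n ↦ ?_)
    have h := hpsi n
    rw [Nat.floor_natCast] at h
    rw [h, Real.rpow_one, Real.norm_of_nonneg (Chebyshev.psi_nonneg _),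
      Real.norm_of_nonneg n.cast_nonneg]
    exact Chebyshev.psi_le_const_mul_self n.cast_nonneg

/-- The Laplace transform of `psiRelError`, in terms of the function that continues
`s ↦ -ζ'(s) / ζ(s) - 1 / (s - 1)` continuously to `1 ≤ re s`. For modulus `1` the residue class
of `1` is all of `ℕ`, so Mathlib's auxiliary function for primes in progressions is this one. -/
lemma laplace_psiRelError {s : ℂ} (hs : 0 < s.re) :
    ∫ v in Ioi (0 : ℝ), (psiRelError v : ℂ) * Complex.exp (-s * v) =
      (LFunctionResidueClassAux (1 : ZMod 1) (1 + s) - 1) / (1 + s) := by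
  have hs0 : s ≠ 0 := by rintro rfl; simp at hs
  have hs1 : 1 + s ≠ 0 := by
    intro h
    have := congrArg Complex.re h
    simp at this
    linarith
  have haux := ArithmeticFunction.vonMangoldt.eqOn_LFunctionResidueClassAux
    (a := (1 : ZMod 1)) isUnit_one (show 1 + s ∈ {s : ℂ | 1 < s.re} by simpa using hs)
  have hres : (residueClass (1 : ZMod 1)) = fun n ↦ ArithmeticFunction.vonMangoldt n := by
    ext n
    simp [residueClass, Subsingleton.elim (n : ZMod 1) 1]
  have hI : IntegrableOn (fun v : ℝ ↦ Complex.exp (-s * v)) (Ioi 0) :=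
    integrableOn_exp_mul_complex_Ioi (by simpa using hs) 0
  have hJ : IntegrableOn (fun v : ℝ ↦
      ((Chebyshev.psi (Real.exp v) / Real.exp v : ℝ) : ℂ) * Complex.exp (-s * v)) (Ioi 0) := by
    refine Integrable.bdd_mul (c := Real.log 4 + 4) hI ?_ (ae_of_all _ fun v ↦ ?_)
    · have := Chebyshev.psi_mono.measurable
      refine Measurable.aestronglyMeasurable ?_
      fun_prop
    · rw [Complex.norm_real, Real.norm_of_nonneg
        (div_nonneg (Chebyshev.psi_nonneg _) (Real.exp_pos v).le), div_le_iff₀ (Real.exp_pos v)]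
      exact Chebyshev.psi_le_const_mul_self (Real.exp_pos v).le
  have hsplit : ∫ v in Ioi (0 : ℝ), (psiRelError v : ℂ) * Complex.exp (-s * v) =
      (∫ v in Ioi (0 : ℝ),
        ((Chebyshev.psi (Real.exp v) / Real.exp v : ℝ) : ℂ) * Complex.exp (-s * v)) -
      ∫ v in Ioi (0 : ℝ), Complex.exp (-s * v) := by
    rw [← integral_sub hJ hI]
    refine setIntegral_congr_fun measurableSet_Ioi fun v (hv : 0 < v) ↦ ?_
    simp only [psiRelError, if_neg hv.not_ge]
    push_cast
    ring
  simp only [hres, Nat.totient_one, Nat.cast_one, inv_one, add_sub_cancel_left] at haux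
  have hL := LSeries_vonMangoldt_eq_integral hs
  rw [hsplit, haux, hL, integral_exp_mul_complex_Ioi (by simpa using hs)]
  simp
  field_simp
  ring

/-- The prime number theorem for the Chebyshev function `ψ`. -/
theorem tendsto_psi_div : Tendsto (fun x ↦ Chebyshev.psi x / x) atTop (𝓝 1) := by
  -- Truncating at `max σ 0` turns continuity on the closed half-plane into continuity everywhere.
  have hmax : ∀ σ τ : ℝ, 0 ≤ (((max σ 0 : ℝ) : ℂ) + Complex.I * τ).re := by intro σ τ; simp
  have h : Tendsto psiRelError atTop (𝓝 0) := by
    refine tendsto_zero_of_continuous_laplace measurable_psiRelError abs_psiRelError_le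
      (fun v hv ↦ if_pos hv) ?_ (F := fun σ τ ↦
        (LFunctionResidueClassAux (1 : ZMod 1) (1 + ((max σ 0 : ℝ) + Complex.I * τ)) - 1) /
          (1 + ((max σ 0 : ℝ) + Complex.I * τ))) ?_ ?_
    · intro u hu v hv huv
      simp only [exp_mul_one_add_psiRelError hu, exp_mul_one_add_psiRelError hv]
      exact Chebyshev.psi_mono (Real.exp_le_exp.mpr huv)
    · simp only [Function.uncurry_def]
      have hc : Continuous fun z : ℝ × ℝ ↦ 1 + (((max z.1 0 : ℝ) : ℂ) + Complex.I * z.2) := by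
        fun_prop
      refine Continuous.div₀ (Continuous.sub ?_ continuous_const) hc fun z hz ↦ ?_
      · refine (ArithmeticFunction.vonMangoldt.continuousOn_LFunctionResidueClassAux
          (1 : ZMod 1)).comp_continuous hc fun z ↦ ?_
        have := hmax z.1 z.2
        simp only [mem_ofPred_eq, Complex.add_re (1 : ℂ), Complex.one_re]
        linarith
      · have := congrArg Complex.re hz
        rw [Complex.add_re, Complex.one_re, Complex.zero_re] at this
        linarith [hmax z.1 z.2]
    · intro σ hσ τ
      simp only [max_eq_left hσ.le]
      exact (laplace_psiRelError (by simpa using hσ)).symm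
  have h2 := (h.comp Real.tendsto_log_atTop).const_add 1
  rw [add_zero] at h2
  refine h2.congr' ?_
  filter_upwards [eventually_gt_atTop 1] with x hx
  simp [psiRelError, (Real.log_pos hx).not_ge, Real.exp_log (one_pos.trans hx)]

/-- The prime number theorem for the Chebyshev function `θ`. -/
theorem tendsto_theta_div : Tendsto (fun x ↦ Chebyshev.theta x / x) atTop (𝓝 1) := by
  have h1 : (fun x : ℝ ↦ Real.sqrt x) =o[atTop] fun x : ℝ ↦ x := by
    refine (isLittleO_iff_tendsto' ?_).mpr ?_
    · filter_upwards [eventually_gt_atTop 0] with x hx h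
      exact absurd h hx.ne'
    · simp_rw [Real.sqrt_div_self]
      exact Real.tendsto_sqrt_atTop.inv_tendsto_atTop
  have h2 := (Chebyshev.isBigO_psi_sub_theta_sqrt.trans_isLittleO h1).tendsto_div_nhds_zero
  have h3 := tendsto_psi_div.sub h2
  rw [sub_zero] at h3
  refine h3.congr fun x ↦ ?_
  simp only [Pi.sub_apply]
  ring

/-- The prime number theorem: `π(x) ~ x / log x`. -/
theorem tendsto_primeCounting_mul_log_div :
    Tendsto (fun x : ℝ ↦ Nat.primeCounting ⌊x⌋₊ * Real.log x / x) atTop (𝓝 1) := by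
  have h1 : (fun x : ℝ ↦ x / Real.log x ^ 2) =o[atTop] fun x : ℝ ↦ x / Real.log x := by
    refine (isLittleO_iff_tendsto' ?_).mpr ?_
    · filter_upwards [eventually_gt_atTop 1] with x hx h
      have := Real.log_pos hx
      exact absurd h (by positivity)
    · refine Real.tendsto_log_atTop.inv_tendsto_atTop.congr' ?_
      filter_upwards [eventually_gt_atTop 1] with x hx
      have := Real.log_pos hx
      simp only [Pi.inv_apply]
      field_simp
  have h2 := (Chebyshev.primeCounting_sub_theta_div_log_isBigO.trans_isLittleO
    h1).tendsto_div_nhds_zero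
  have h3 := h2.add tendsto_theta_div
  rw [zero_add] at h3
  refine h3.congr' ?_
  filter_upwards [eventually_gt_atTop 1] with x hx
  have := Real.log_pos hx
  field_simp
  ring

/-! ### Integrals of asymptotic functions -/

/-- An integral of a function asymptotic to a nonnegative derivative `F'` is asymptotic to `F`,
provided `F` is unbounded. -/
lemma isEquivalent_integral_of_isEquivalent_deriv {f F F' : ℝ → ℝ} {a : ℝ}
    (hf : ∀ x ≥ a, IntervalIntegrable f volume a x)
    (hF : ∀ x ≥ a, HasDerivAt F (F' x) x) (hF' : ContinuousOn F' (Ici a))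
    (hpos : ∀ᶠ x in atTop, 0 ≤ F' x) (hlim : Tendsto F atTop atTop) (hequiv : f ~[atTop] F') :
    (fun x ↦ ∫ t in a..x, f t) ~[atTop] F := by
  refine isLittleO_iff.mpr fun ε hε ↦ ?_
  -- Beyond `X` the integrands differ by at most `ε / 2 * F'`; the part up to `X` is a constant,
  -- absorbed by another `ε / 2 * F x`.
  obtain ⟨X, hX⟩ := eventually_atTop.mp
    (((hequiv.def (half_pos hε)).and hpos).and (eventually_ge_atTop a))
  have haX : a ≤ X := (hX X le_rfl).2
  filter_upwards [eventually_ge_atTop X, hlim.eventually_ge_atTop 0,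
    hlim.eventually_ge_atTop ((|(∫ t in a..X, f t) - F X| + ε / 2 * |F X|) / (ε / 2))]
    with x hx hFx hbig
  rw [div_le_iff₀ (half_pos hε)] at hbig
  have hf1 := hf X haX
  have hf2 : IntervalIntegrable f volume X x := hf1.symm.trans (hf x (haX.trans hx))
  have hcont : IntervalIntegrable F' volume X x := by
    refine (hF'.mono ?_).intervalIntegrable
    rw [uIcc_of_le hx]
    exact fun y hy ↦ haX.trans hy.1
  have hFTC : ∫ t in X..x, F' t = F x - F X := by
    refine intervalIntegral.integral_eq_sub_of_hasDerivAt (fun y hy ↦ hF y ?_) hcont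
    rw [uIcc_of_le hx] at hy
    exact haX.trans hy.1
  have hdiff : |(∫ t in X..x, f t) - (F x - F X)| ≤ ε / 2 * (F x - F X) := by
    rw [← hFTC, ← intervalIntegral.integral_sub hf2 hcont, ← intervalIntegral.integral_const_mul]
    refine (intervalIntegral.abs_integral_le_integral_abs hx).trans
      (intervalIntegral.integral_mono_on hx (hf2.sub hcont).abs (hcont.const_mul _) fun y hy ↦ ?_)
    obtain ⟨⟨h1, h2⟩, -⟩ := hX y hy.1
    simpa only [Pi.sub_apply, Real.norm_eq_abs, abs_of_nonneg h2] using h1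
  have hsplit := intervalIntegral.integral_add_adjacent_intervals hf1 hf2
  simp only [Pi.sub_apply, Real.norm_eq_abs, abs_of_nonneg hFx]
  rw [← hsplit]
  have h1 : (∫ t in a..X, f t) + (∫ t in X..x, f t) - F x =
      ((∫ t in a..X, f t) - F X) + ((∫ t in X..x, f t) - (F x - F X)) := by ring
  rw [h1]
  refine (abs_add_le _ _).trans ?_
  have h2 := neg_abs_le (F X)
  nlinarith

lemma hasDerivAt_div_log_sq {x : ℝ} (hx : 1 < x) :
    HasDerivAt (fun x ↦ x / Real.log x ^ 2) (1 / Real.log x ^ 2 - 2 / Real.log x ^ 3) x := by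
  have hlog := Real.log_pos hx
  have h := (hasDerivAt_id x).div ((Real.hasDerivAt_log (by linarith)).pow 2)
    (pow_ne_zero 2 hlog.ne')
  refine h.congr_deriv ?_
  simp only [id]
  field_simp
  simp
  field_simp

lemma tendsto_div_log_sq_atTop : Tendsto (fun x ↦ x / Real.log x ^ 2) atTop atTop := by
  have h := (Real.tendsto_exp_div_pow_atTop 2).comp Real.tendsto_log_atTop
  refine h.congr' ?_
  filter_upwards [eventually_gt_atTop 0] with x hx
  simp [Real.exp_log hx]

lemma monotone_primeCounting_floor :
    Monotone fun t : ℝ ↦ (Nat.primeCounting ⌊t⌋₊ : ℝ) :=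
  fun _ _ h ↦ Nat.cast_le.mpr (Nat.monotone_primeCounting (Nat.floor_mono h))

/-- The integral arising from partial summation of `log (log p)` satisfies
`∫ π(t) / (t log t) dt ~ x / (log x) ^ 2`. -/
lemma isEquivalent_integral_primeCounting_div :
    (fun x : ℝ ↦ ∫ t in (2 : ℝ)..x, Nat.primeCounting ⌊t⌋₊ / (t * Real.log t)) ~[atTop]
      fun x ↦ x / Real.log x ^ 2 := by
  refine isEquivalent_integral_of_isEquivalent_deriv
    (F' := fun x ↦ 1 / Real.log x ^ 2 - 2 / Real.log x ^ 3) ?_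
    (fun x hx ↦ hasDerivAt_div_log_sq (by linarith)) ?_ ?_ tendsto_div_log_sq_atTop ?_
  · intro x hx
    have h1 : ContinuousOn (fun t : ℝ ↦ (t * Real.log t)⁻¹) (uIcc 2 x) := by
      intro t ht
      rw [uIcc_of_le hx] at ht
      have h0 : t ≠ 0 := by linarith [ht.1]
      have : t * Real.log t ≠ 0 :=
        mul_ne_zero h0 (Real.log_pos (by linarith [ht.1])).ne'
      exact ContinuousAt.continuousWithinAt (by fun_prop)
    simpa [div_eq_mul_inv] using
      (monotone_primeCounting_floor.monotoneOn _).intervalIntegrable.mul_continuousOn h1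
  · intro t (ht : 2 ≤ t)
    have h0 : t ≠ 0 := by linarith
    have h1 := (Real.log_pos (by linarith : 1 < t)).ne'
    have h2 : Real.log t ^ 2 ≠ 0 := pow_ne_zero _ h1
    have h3 : Real.log t ^ 3 ≠ 0 := pow_ne_zero _ h1
    exact ContinuousAt.continuousWithinAt (by fun_prop)
  · filter_upwards [Real.tendsto_log_atTop.eventually_ge_atTop 2] with x hx
    have : 1 / Real.log x ^ 2 - 2 / Real.log x ^ 3 =
        (Real.log x - 2) / Real.log x ^ 3 := by field_simp
    rw [this]
    exact div_nonneg (by linarith) (by positivity)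
  · have hne : ∀ᶠ x in atTop, 1 / Real.log x ^ 2 - 2 / Real.log x ^ 3 ≠ 0 := by
      filter_upwards [Real.tendsto_log_atTop.eventually_gt_atTop 2] with x hx
      have : 1 / Real.log x ^ 2 - 2 / Real.log x ^ 3 =
          (Real.log x - 2) / Real.log x ^ 3 := by field_simp
      rw [this]
      exact (div_pos (by linarith) (by positivity)).ne'
    refine (isEquivalent_iff_tendsto_one hne).mpr ?_
    have h1 : Tendsto (fun x ↦ 1 - 2 * (Real.log x)⁻¹) atTop (𝓝 1) := by
      simpa using (Real.tendsto_log_atTop.inv_tendsto_atTop.const_mul 2).const_sub 1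
    have h2 := tendsto_primeCounting_mul_log_div.div h1 one_ne_zero
    rw [div_one] at h2
    refine h2.congr' ?_
    filter_upwards [Real.tendsto_log_atTop.eventually_gt_atTop 2, eventually_gt_atTop 0]
      with x hx hx0
    have h3 : Real.log x - 2 ≠ 0 := by linarith
    have h4 : 1 - 2 * (Real.log x)⁻¹ = (Real.log x - 2) / Real.log x := by field_simp
    have h5 : 1 / Real.log x ^ 2 - 2 / Real.log x ^ 3 =
        (Real.log x - 2) / Real.log x ^ 3 := by field_simp
    simp only [Pi.div_apply]
    rw [h4, h5]
    field_simp

/-! ### The geometric mean of `log p` -/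

lemma primeCounting_eq_sum_ite (n : ℕ) : (Nat.primeCounting n : ℝ) =
    ∑ k ∈ Finset.Icc 0 n, if k.Prime then (1 : ℝ) else 0 := by
  simp [Nat.primeCounting, Nat.primeCounting', Nat.count_eq_card_filter_range,
    Nat.range_succ_eq_Icc_zero]

/-- Partial summation for `∑ log (log p)`. -/
lemma sum_log_log_prime {x : ℝ} (hx : 2 ≤ x) :
    ∑ p ∈ (Finset.Icc 1 ⌊x⌋₊).filter Nat.Prime, Real.log (Real.log p) =
      Nat.primeCounting ⌊x⌋₊ * Real.log (Real.log x) -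
        ∫ t in (2 : ℝ)..x, Nat.primeCounting ⌊t⌋₊ / (t * Real.log t) := by
  set a : ℕ → ℝ := fun k ↦ if k.Prime then 1 else 0 with ha
  have hderiv : ∀ t ∈ Icc 2 x,
      HasDerivAt (fun t ↦ Real.log (Real.log t)) (t * Real.log t)⁻¹ t := by
    intro t ht
    have h0 : t ≠ 0 := by linarith [ht.1]
    have h1 := (Real.log_pos (by linarith [ht.1] : 1 < t)).ne'
    refine ((Real.hasDerivAt_log h0).log h1).congr_deriv ?_
    field_simp
  have hcont : ContinuousOn (fun t : ℝ ↦ (t * Real.log t)⁻¹) (Icc 2 x) := by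
    intro t ht
    have h0 : t ≠ 0 := by linarith [ht.1]
    have : t * Real.log t ≠ 0 :=
      mul_ne_zero h0 (Real.log_pos (by linarith [ht.1])).ne'
    exact ContinuousAt.continuousWithinAt (by fun_prop)
  have habel := sum_mul_eq_sub_integral_mul₁ a (f := fun t ↦ Real.log (Real.log t))
    (by simp [a, Nat.not_prime_zero]) (by simp [a, Nat.not_prime_one]) x
    (fun t ht ↦ (hderiv t ht).differentiableAt)
    ((hcont.congr fun t ht ↦ (hderiv t ht).deriv).integrableOn_Icc)
  simp only [ha, ← primeCounting_eq_sum_ite] at habel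
  have hsum : ∑ p ∈ (Finset.Icc 1 ⌊x⌋₊).filter Nat.Prime, Real.log (Real.log p) =
      ∑ k ∈ Finset.Icc 0 ⌊x⌋₊,
        Real.log (Real.log k) * if k.Prime then (1 : ℝ) else 0 := by
    simp only [mul_ite, mul_one, mul_zero, ← Finset.sum_filter]
    refine Finset.sum_congr ?_ fun _ _ ↦ rfl
    ext p
    simp only [Finset.mem_filter, Finset.mem_Icc]
    exact ⟨fun h ↦ ⟨⟨p.zero_le, h.1.2⟩, h.2⟩, fun h ↦ ⟨⟨h.2.one_lt.le, h.1.2⟩, h.2⟩⟩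
  rw [hsum, habel, mul_comm, intervalIntegral.integral_of_le hx]
  congr 1
  refine setIntegral_congr_fun measurableSet_Ioc fun t ht ↦ ?_
  simp only [(hderiv t ⟨ht.1.le, ht.2⟩).deriv]
  rw [div_eq_inv_mul]

lemma prod_log_prime_pos (x : ℝ) :
    0 < ∏ p ∈ (Finset.Icc 1 ⌊x⌋₊).filter Nat.Prime, Real.log (p : ℝ) :=
  Finset.prod_pos fun _ hp ↦ Real.log_pos (by exact_mod_cast (Finset.mem_filter.mp hp).2.one_lt)

lemma primeCounting_floor_pos {x : ℝ} (hx : 2 ≤ x) : 0 < Nat.primeCounting ⌊x⌋₊ :=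
  
  (show 0 < Nat.primeCounting 2 by decide).trans_le (Nat.monotone_primeCounting (Nat.le_floor hx))

/-- The geometric mean of `log p` over the primes `p ≤ x` is `log x` times
`exp (-(1 / π(x)) ∫ π(t) / (t log t) dt)`. -/
lemma geom_mean_log_prime {x : ℝ} (hx : 2 ≤ x) :
    (∏ p ∈ (Finset.Icc 1 ⌊x⌋₊).filter Nat.Prime, Real.log (p : ℝ)) ^
        ((1 : ℝ) / (Nat.primeCounting ⌊x⌋₊ : ℝ)) =
      Real.log x * Real.exp (-((∫ t in (2 : ℝ)..x, Nat.primeCounting ⌊t⌋₊ / (t * Real.log t)) /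
        Nat.primeCounting ⌊x⌋₊)) := by
  have hpi : (Nat.primeCounting ⌊x⌋₊ : ℝ) ≠ 0 := by exact_mod_cast (primeCounting_floor_pos hx).ne'
  have hlog : 0 < Real.log x := Real.log_pos (by linarith)
  rw [Real.rpow_def_of_pos (prod_log_prime_pos x), Real.log_prod fun p hp ↦ (Real.log_pos
    (by exact_mod_cast (Finset.mem_filter.mp hp).2.one_lt)).ne', sum_log_log_prime hx]
  nth_rewrite 2 [← Real.exp_log hlog]
  rw [← Real.exp_add]
  congr 1
  field_simp
  ring

/-- If `δ → 0` and `L δ → 1`, then `L (1 - e ^ (-δ)) → 1`. -/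
lemma tendsto_mul_one_sub_exp_neg {α : Type*} {l : Filter α} {L δ : α → ℝ}
    (hδ : Tendsto δ l (𝓝 0)) (hL : Tendsto (fun x ↦ L x * δ x) l (𝓝 1)) :
    Tendsto (fun x ↦ L x * (1 - Real.exp (-δ x))) l (𝓝 1) := by
  have h1 : HasDerivAt (fun y : ℝ ↦ 1 - Real.exp (-y)) 1 0 := by
    simpa using ((hasDerivAt_neg (0 : ℝ)).exp.const_sub 1)
  have h2 : Tendsto (dslope (fun y : ℝ ↦ 1 - Real.exp (-y)) 0) (𝓝 0) (𝓝 1) := by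
    have h := (continuousAt_dslope_same.mpr h1.differentiableAt).tendsto
    rwa [dslope_same, h1.deriv] at h
  have h3 := hL.mul (h2.comp hδ)
  rw [one_mul] at h3
  refine h3.congr fun x ↦ ?_
  have h4 := sub_smul_dslope (fun y : ℝ ↦ 1 - Real.exp (-y)) 0 (δ x)
  simp only [sub_zero, smul_eq_mul, neg_zero, Real.exp_zero, sub_self] at h4
  rw [← h4, Function.comp_apply]
  ring

/-- The geometric mean of `log p` over the primes `p ≤ x` is `log x - 1 + o(1)`. -/
theorem tendsto_log_sub_geom_mean : Tendsto (fun x : ℝ ↦ Real.log x - 1 -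
    (∏ p ∈ (Finset.Icc 1 ⌊x⌋₊).filter Nat.Prime, Real.log (p : ℝ)) ^
        ((1 : ℝ) / (Nat.primeCounting ⌊x⌋₊ : ℝ))) atTop (𝓝 0) := by
  set J : ℝ → ℝ := fun x ↦ ∫ t in (2 : ℝ)..x, Nat.primeCounting ⌊t⌋₊ / (t * Real.log t) with hJ
  have hJlim : Tendsto (fun x ↦ J x / (x / Real.log x ^ 2)) atTop (𝓝 1) := by
    refine (isEquivalent_iff_tendsto_one ?_).mp isEquivalent_integral_primeCounting_div
    filter_upwards [eventually_gt_atTop 1] with x hx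
    have := Real.log_pos hx
    positivity
  have hL : Tendsto (fun x ↦ Real.log x * (J x / Nat.primeCounting ⌊x⌋₊)) atTop (𝓝 1) := by
    have h := hJlim.div tendsto_primeCounting_mul_log_div one_ne_zero
    rw [div_one] at h
    refine h.congr' ?_
    filter_upwards [eventually_ge_atTop 2] with x hx
    have := Real.log_pos (by linarith : 1 < x)
    have hpi : (Nat.primeCounting ⌊x⌋₊ : ℝ) ≠ 0 := by
      exact_mod_cast (primeCounting_floor_pos hx).ne'
    have hx0 : x ≠ 0 := by linarith
    simp only [Pi.div_apply]
    field_simp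
  have hδ : Tendsto (fun x ↦ J x / Nat.primeCounting ⌊x⌋₊) atTop (𝓝 0) := by
    have h := hL.mul Real.tendsto_log_atTop.inv_tendsto_atTop
    rw [mul_zero] at h
    refine h.congr' ?_
    filter_upwards [eventually_gt_atTop 1] with x hx
    have := Real.log_pos hx
    simp only [Pi.inv_apply]
    field_simp
  have h := (tendsto_mul_one_sub_exp_neg hδ hL).sub_const 1
  rw [sub_self] at h
  refine h.congr' ?_
  filter_upwards [eventually_ge_atTop 2] with x hx
  rw [geom_mean_log_prime hx]
  ring

end

theorem lemmaA1 :
    (∃ ε : ℝ → ℝ, ε =o[atTop] (fun _ => (1 : ℝ)) ∧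
      ∀ x : ℝ, 2 ≤ x →
        ∏ p ∈ (Finset.Icc 1 ⌊x⌋₊).filter Nat.Prime, Real.log (p : ℝ) =
          (Real.log x - 1 - ε x) ^ (Nat.primeCounting ⌊x⌋₊)) ∧
    (fun x : ℝ =>
        (∏ p ∈ (Finset.Icc 1 ⌊x⌋₊).filter Nat.Prime, Real.log (p : ℝ)) ^
          ((1 : ℝ) / (Nat.primeCounting ⌊x⌋₊ : ℝ)))
      ~[atTop] (fun x : ℝ => Real.log x - 1) := by
  refine ⟨⟨_, (isLittleO_one_iff ℝ).mpr tendsto_log_sub_geom_mean, fun x hx ↦ ?_⟩, ?_⟩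
  · rw [sub_sub_cancel, one_div, Real.rpow_inv_natCast_pow (prod_log_prime_pos x).le
      (primeCounting_floor_pos hx).ne']
  · have h1 : Tendsto (fun x : ℝ ↦ ‖Real.log x - 1‖) atTop atTop :=
      tendsto_norm_atTop_atTop.comp (tendsto_atTop_add_const_right _ (-1) Real.tendsto_log_atTop)
    have h2 := ((isLittleO_one_iff ℝ).mpr tendsto_log_sub_geom_mean).trans
      ((isLittleO_const_left_of_ne one_ne_zero).mpr h1)
    exact h2.neg_left.congr_left fun x ↦ by simp only [Pi.sub_apply]; ring
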